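/- **Theorem.** Let $\mu$ be a nontrivial (i.e. with infinite support) finite positive Borel measure on the unit circle $\mathbb T$, with monic orthogonal polynomials $\Phi_n(\cdot;\mu)$, orthonormal polynomials $\varphi_n(\cdot;\mu)=\kappa_n\Phi_n(\cdot;\mu)$, $\kappa_n>0$, Christoffel–Darboux kernels $K_n(z,w;\mu)=\sum_{j=0}^n\overline{\varphi_j(w;\mu)}\,\varphi_j(z;\mu)$ and Verblunsky coefficients $\alpha_n(\mu)=-\overline{\Phi_{n+1}(0;\mu)}$. For a polynomial $q$ of exact degree $d$ put $q^*(z)=z^{d}\,\overline{q(1/\overline z)}$. Put $\tau_n(\mu)=\Phi_n(1;\mu)/\Phi_n^*(1;\mu)$ for $n\ge 0$ and, for $n\ge1$ (omitting the argument $\mu$), $$g_n=\frac12\,\frac{|1-\tau_{n-1}\alpha_{n-1}|^2}{1-\operatorname{Re}(\tau_{n-1}\alpha_{n-1})},\qquad c_n=\frac{\operatorname{Im}(\tau_{n-1}\alpha_{n-1})}{\operatorname{Re}(\tau_{n-1}\alpha_{n-1})-1}.$$ Let $$\xi_n(\mu)=\mu(\mathbb T)\prod_{j=1}^n 2\bigl(1-g_j(\mu)\bigr),\qquad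 R_n(z;\mu)=\xi_n(\mu)\,K_n(z,1;\mu),\qquad n\ge0.$$ (This is the normalization in which $R_0=1$ and $R_{n+1}(z)=[(1+ic_{n+1})z+(1-ic_{n+1})]R_n(z)-4(1-g_n)g_{n+1}\,z\,R_{n-1}(z)$ for $n\ge1$.) Let $m\ge1$, and let $G_{2m}$ be a self-reciprocal polynomial ($G_{2m}^*=G_{2m}$) of exact degree $2m$ with $G_{2m}(\zeta)/\zeta^m\ge0$ for $\zeta\in\operatorname{supp}\mu$. Let $d\nu(\zeta)=\frac{G_{2m}(\zeta)}{\zeta^m}\,d\mu(\zeta)=|G_{2m}(\zeta)|\,d\mu(\zeta)$; the quantities $c_n(\nu)$, $g_n(\nu)$, $R_n(\cdot;\nu)$ are formed from $\nu$ in the same way. Then for every $n\ge0$ there are unique complex numbers $\gamma_n^{(m)}$ and $a_1^{(n,m)},\dots,a_{2m}^{(n,m)}$ with $$\gamma_n^{(m)}G_{2m}(z)R_n(z;\nu)=R_{n+2m}(z;\mu)+\sum_{j=1}^m a_{2j-1}^{(n,m)}z^{j-1}R_{n+2m-2j+1}(z;\mu)+\sum_{j=1}^m a_{2j}^{(n,m)}z^{j}R_{n+2m-2j}(z;\mu).$$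 Moreover $\gamma_n^{(m)}\ne0$ for all $n\ge0$, $$\gamma_0^{(m)}=\bigl[\overline{G_{2m}(0)}\bigr]^{-1}\prod_{j=1}^{2m}[1+ic_j(\mu)],$$ and, for $n\ge1$ and $N=n+2m$, all the denominators below are nonzero and $$\frac{\gamma_n^{(m)}}{\gamma_{n-1}^{(m)}}=\frac12\left[[1-ic_{N-1}(\mu)]\frac{[1-ic_N(\mu)]+a_1^{(n,m)}}{[1-ic_{N-1}(\mu)]+a_1^{(n-1,m)}}+[1+ic_N(\mu)]\right],$$ $$c_n(\nu)=\frac i2\,\frac{\gamma_{n-1}^{(m)}}{\gamma_n^{(m)}}\left[[1-ic_{N-1}(\mu)]\frac{[1-ic_N(\mu)]+a_1^{(n,m)}}{[1-ic_{N-1}(\mu)]+a_1^{(n-1,m)}}-[1+ic_N(\mu)]\right],$$ $$g_n(\nu)=1-\frac12\,\frac{\gamma_{n-1}^{(m)}}{\gamma_n^{(m)}}\;\frac{\xi_N(\mu)+\sum_{j=1}^m a_{2j-1}^{(n,m)}\xi_{N-2j+1}(\mu)+\sum_{j=1}^m a_{2j}^{(n,m)}\xi_{N-2j}(\mu)}{\xi_{N-1}(\mu)+\sum_{j=1}^m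 a_{2j-1}^{(n-1,m)}\xi_{N-2j}(\mu)+\sum_{j=1}^m a_{2j}^{(n-1,m)}\xi_{N-2j-1}(\mu)}.$$ -/

import Mathlib

open MeasureTheory Polynomial
open scoped ComplexConjugate

noncomputable section

namespace OPUC

/-- A nontrivial positive measure on the unit circle `𝕋`, viewed as a measure on `ℂ`: finite,
carried by `𝕋`, and with infinite support. -/
structure IsNontrivial (μ : Measure ℂ) : Prop where
  finite : IsFiniteMeasure μ
  circle : μ (Metric.sphere (0 : ℂ) 1)ᶜ = 0
  infinite_support : μ.support.Infinite

/-- The inner product `⟨p, q⟩ = ∫ conj (p ζ) * q ζ dμ(ζ)` on polynomials. -/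
def ip (μ : Measure ℂ) (p q : ℂ[X]) : ℂ :=
  ∫ ζ, conj (p.eval ζ) * q.eval ζ ∂μ

/-- The monic orthogonal polynomials `Φ_n(·; μ)`, by the Gram-Schmidt process applied to
`1, z, z², …`. -/
def monicOP (μ : Measure ℂ) (n : ℕ) : ℂ[X] :=
  X ^ n - ∑ k : Fin n,
    C (ip μ (monicOP μ k.val) (X ^ n) / ip μ (monicOP μ k.val) (monicOP μ k.val)) *
      monicOP μ k.val
termination_by n
decreasing_by exact k.isLt

/-- The orthonormal polynomials `φ_n = κ_n Φ_n`, with `κ_n = ‖Φ_n‖⁻¹ > 0`. -/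
def orthonormalOP (μ : Measure ℂ) (n : ℕ) : ℂ[X] :=
  C (((Real.sqrt (∫ ζ, ‖(monicOP μ n).eval ζ‖ ^ 2 ∂μ))⁻¹ : ℝ) : ℂ) * monicOP μ n

/-- The Christoffel-Darboux kernel `K_n(·, w; μ) = ∑_{j ≤ n} conj (φ_j(w)) φ_j`, as a polynomial
in its first variable. -/
def cdKernel (μ : Measure ℂ) (n : ℕ) (w : ℂ) : ℂ[X] :=
  ∑ j ∈ Finset.range (n + 1), C (conj ((orthonormalOP μ j).eval w)) * orthonormalOP μ j

/-- The reversed polynomial `q*(z) = z^{deg q} conj (q(1 / conj z))`. -/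
def reversed (q : ℂ[X]) : ℂ[X] := (q.map (starRingEnd ℂ)).reverse

/-- The Verblunsky coefficients `α_n = - conj (Φ_{n+1}(0))`. -/
def verblunsky (μ : Measure ℂ) (n : ℕ) : ℂ := -conj ((monicOP μ (n + 1)).eval 0)

/-- `τ_n = Φ_n(1) / Φ_n*(1)`. -/
def tau (μ : Measure ℂ) (n : ℕ) : ℂ :=
  (monicOP μ n).eval 1 / (reversed (monicOP μ n)).eval 1

/-- The parameters `g_n`, `n ≥ 1` (the value at `n = 0` has no meaning). -/
def g (μ : Measure ℂ) (n : ℕ) : ℝ :=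
  1 / 2 * (‖1 - tau μ (n - 1) * verblunsky μ (n - 1)‖ ^ 2 /
    (1 - (tau μ (n - 1) * verblunsky μ (n - 1)).re))

/-- The parameters `c_n`, `n ≥ 1` (the value at `n = 0` has no meaning). -/
def c (μ : Measure ℂ) (n : ℕ) : ℝ :=
  (tau μ (n - 1) * verblunsky μ (n - 1)).im /
    ((tau μ (n - 1) * verblunsky μ (n - 1)).re - 1)

/-- The normalizing constants `ξ_n = μ(𝕋) ∏_{j=1}^n 2 (1 - g_j)`. The factors `2` are those for
which `R_n = ξ_n K_n(·, 1)` satisfies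
`R_{n+1} = [(1 + i c_{n+1}) z + (1 - i c_{n+1})] R_n - 4 (1 - g_n) g_{n+1} z R_{n-1}`. -/
def xi (μ : Measure ℂ) (n : ℕ) : ℝ :=
  μ.real Set.univ * ∏ j ∈ Finset.Icc 1 n, (2 * (1 - g μ j))

/-- The normalized kernels `R_n(·; μ) = ξ_n(μ) K_n(·, 1; μ)`. -/
def R (μ : Measure ℂ) (n : ℕ) : ℂ[X] := C (xi μ n : ℂ) * cdKernel μ n 1

/-- `G` is an admissible Christoffel factor for `μ`: a self-reciprocal polynomial of exact degree
`2m` such that `G(ζ) / ζ^m` is a non-negative real number for all `ζ ∈ supp μ`. -/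
structure IsChristoffelFactor (μ : Measure ℂ) (m : ℕ) (G : ℂ[X]) : Prop where
  natDegree_eq : G.natDegree = 2 * m
  reversed_eq : reversed G = G
  nonneg : ∀ ζ ∈ μ.support, ∃ r : ℝ, 0 ≤ r ∧ G.eval ζ / ζ ^ m = (r : ℂ)

/-- The transformed measure `dν(ζ) = |G(ζ)| dμ(ζ)`, which is `(G(ζ) / ζ^m) dμ(ζ)` for a
Christoffel factor `G` of degree `2m`. -/
def christoffel (μ : Measure ℂ) (G : ℂ[X]) : Measure ℂ :=
  μ.withDensity fun ζ => ENNReal.ofReal ‖G.eval ζ‖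

/-- The connection formula of index `n`, with coefficients `γ` and `a 1, …, a (2m)`:
`γ G R_n(·; ν) = R_{n+2m}(·; μ) + ∑_{j=1}^m a_{2j-1} z^{j-1} R_{n+2m-2j+1}(·; μ)
  + ∑_{j=1}^m a_{2j} z^j R_{n+2m-2j}(·; μ)`. -/
def ConnectionFormula (μ : Measure ℂ) (m : ℕ) (G : ℂ[X]) (n : ℕ) (γ : ℂ) (a : ℕ → ℂ) : Prop :=
  C γ * G * R (christoffel μ G) n =
    R μ (n + 2 * m)
      + ∑ j ∈ Finset.Icc 1 m, C (a (2 * j - 1)) * X ^ (j - 1) * R μ (n + 2 * m - 2 * j + 1)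
      + ∑ j ∈ Finset.Icc 1 m, C (a (2 * j)) * X ^ j * R μ (n + 2 * m - 2 * j)

end OPUC

end

/-!
The connection formula is an expansion in a space of polynomials cut out by orthogonality, and the
formulas for `γ_n`, `c_n(ν)` and `g_n(ν)` are read off from its top coefficient, its constant
coefficient and one moment.

The kernel `K_n(·, 1)` reproduces the value at `1` of the polynomials of degree at most `n`
(`ip_cdKernel`), so `R_n` is orthogonal to `z ^ j * (z - 1)` for `j < n`, and it is determined by
this up to a factor (`exists_eq_C_mul_R`). With `N = n + 2m`, the right-hand side of the connection
formula is `∑ b_k z ^ ⌊k/2⌋ R_{N-k}(μ)`, summed over `k ≤ 2m`, with `b_0 = 1`. These `2m + 1`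
polynomials are linearly independent and span the polynomials of degree at most `N` that are
orthogonal to `z ^ i * (z - 1)`, `m ≤ i < m + n` (`exists_eq_sum_R`, `eq_zero_of_sum_R_eq_zero`).
On the circle `⟨G p, z ^ m q⟩_μ = ⟨p, q⟩_ν` (`ip_mul_X_pow_mul`), so `G R_n(ν)` lies in that space;
its top coefficient is nonzero, which allows the normalization `b_0 = 1`.

The Szegő recursion (`monicOP_succ`) shows that `|α_n| < 1` and `Φ_n(1) ≠ 0`, and turns the
definitions of `g_n` and `c_n` into `ξ_n > 0` and the fact that the top coefficient of `R_n` is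
`∏ (1 + i c_j)` (`coeff_R_self`); since `K_n(·, 1)` is self-reciprocal, the constant coefficient of
`R_n` is the conjugate of the top one (`coeff_R_zero`). Comparing in the connection formula the top
coefficients (`ConnectionFormula.coeff_top`) and the constant coefficients
(`ConnectionFormula.coeff_zero`) for `n` and `n - 1` gives
`γ_n (1 ± i c_n(ν))` in terms of `γ_{n-1}`, hence the ratio of the `γ`s and `c_n(ν)`. Pairing the
formula with `z ^ m` replaces every `z ^ j R_k` by `ξ_k` and `G R_n(ν)` by `ξ_n(ν)`
(`ConnectionFormula.xi_eq`), which gives `g_n(ν)` because `ξ_n / ξ_{n-1} = 2 (1 - g_n)`.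
-/

namespace OPUC

variable {μ : Measure ℂ}

/-! ### The inner product on polynomials -/

theorem IsNontrivial.ae_norm_eq_one (hμ : IsNontrivial μ) : ∀ᵐ ζ ∂μ, ‖ζ‖ = 1 := by
  have h : ∀ᵐ ζ ∂μ, ζ ∈ Metric.sphere (0 : ℂ) 1 := hμ.circle
  filter_upwards [h] with ζ hζ using by simpa using hζ

theorem IsNontrivial.integrable_of_continuous (hμ : IsNontrivial μ) {E : Type*}
    [NormedAddCommGroup E] {f : ℂ → E} (hf : Continuous f) : Integrable f μ := by
  have := hμ.finite
  have h : μ.restrict (Metric.sphere (0 : ℂ) 1) = μ :=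
    Measure.restrict_eq_self_of_ae_mem (show ∀ᵐ ζ ∂μ, ζ ∈ Metric.sphere (0 : ℂ) 1 from hμ.circle)
  rw [← h]
  exact hf.continuousOn.integrableOn_compact (isCompact_sphere 0 1)

theorem IsNontrivial.integrable_conj_mul (hμ : IsNontrivial μ) (p q : ℂ[X]) :
    Integrable (fun ζ => conj (p.eval ζ) * q.eval ζ) μ :=
  hμ.integrable_of_continuous
    ((Complex.continuous_conj.comp p.continuous).mul q.continuous)

theorem ip_zero_right (p : ℂ[X]) : ip μ p 0 = 0 := by simp [ip]

theorem ip_C_mul_right (a : ℂ) (p q : ℂ[X]) : ip μ p (C a * q) = a * ip μ p q := by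
  simp only [ip, ← integral_const_mul, eval_mul, eval_C]
  congr 1 with ζ
  ring

theorem conj_ip (p q : ℂ[X]) : conj (ip μ p q) = ip μ q p := by
  simp only [ip, ← integral_conj, map_mul, Complex.conj_conj]
  congr 1 with ζ
  ring

theorem ip_C_mul_left (a : ℂ) (p q : ℂ[X]) : ip μ (C a * p) q = conj a * ip μ p q := by
  rw [← conj_ip, ip_C_mul_right, map_mul, conj_ip]

theorem ip_eq_zero_symm {p q : ℂ[X]} (h : ip μ p q = 0) : ip μ q p = 0 := by
  rw [← conj_ip, h, map_zero]

theorem IsNontrivial.ip_add_right (hμ : IsNontrivial μ) (p q r : ℂ[X]) :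
    ip μ p (q + r) = ip μ p q + ip μ p r := by
  simp only [ip, eval_add, mul_add]
  exact integral_add (hμ.integrable_conj_mul p q) (hμ.integrable_conj_mul p r)

theorem IsNontrivial.ip_sub_right (hμ : IsNontrivial μ) (p q r : ℂ[X]) :
    ip μ p (q - r) = ip μ p q - ip μ p r := by
  simp only [ip, eval_sub, mul_sub]
  exact integral_sub (hμ.integrable_conj_mul p q) (hμ.integrable_conj_mul p r)

theorem IsNontrivial.ip_add_left (hμ : IsNontrivial μ) (p q r : ℂ[X]) :
    ip μ (p + q) r = ip μ p r + ip μ q r := by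
  rw [← conj_ip, hμ.ip_add_right, map_add, conj_ip, conj_ip]

theorem IsNontrivial.ip_sub_left (hμ : IsNontrivial μ) (p q r : ℂ[X]) :
    ip μ (p - q) r = ip μ p r - ip μ q r := by
  rw [← conj_ip, hμ.ip_sub_right, map_sub, conj_ip, conj_ip]

theorem IsNontrivial.ip_sum_right (hμ : IsNontrivial μ) {ι : Type*} (s : Finset ι) (p : ℂ[X])
    (f : ι → ℂ[X]) : ip μ p (∑ i ∈ s, f i) = ∑ i ∈ s, ip μ p (f i) := by
  classical
  induction s using Finset.induction_on with
  | empty => simp [ip_zero_right]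
  | insert a s ha ih => rw [Finset.sum_insert ha, Finset.sum_insert ha, hμ.ip_add_right, ih]

theorem IsNontrivial.ip_X_pow_mul_X_pow_mul (hμ : IsNontrivial μ) (j : ℕ) (p q : ℂ[X]) :
    ip μ (X ^ j * p) (X ^ j * q) = ip μ p q := by
  refine integral_congr_ae ?_
  filter_upwards [hμ.ae_norm_eq_one] with ζ hζ
  have h : conj (ζ ^ j) * ζ ^ j = 1 := by rw [Complex.conj_mul']; simp [hζ]
  simp only [eval_mul, eval_pow, eval_X, map_mul] at h ⊢
  linear_combination (conj (p.eval ζ) * q.eval ζ) * h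

theorem IsNontrivial.ip_X_mul_X_mul (hμ : IsNontrivial μ) (p q : ℂ[X]) :
    ip μ (X * p) (X * q) = ip μ p q := by
  simpa using hμ.ip_X_pow_mul_X_pow_mul 1 p q

theorem ip_self_eq_ofReal (p : ℂ[X]) : ip μ p p = ((∫ ζ, ‖p.eval ζ‖ ^ 2 ∂μ : ℝ) : ℂ) := by
  refine Eq.trans ?_ integral_ofReal
  refine integral_congr_ae (Filter.Eventually.of_forall fun ζ => ?_)
  simp [Complex.conj_mul']

theorem IsNontrivial.infinite_of_isClosed (hμ : IsNontrivial μ) {t : Set ℂ} (ht : IsClosed t)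
    (h : ∀ᵐ ζ ∂μ, ζ ∈ t) : t.Infinite :=
  hμ.infinite_support.mono (Measure.support_subset_of_isClosed ht h)

/-- The inner product is definite: a nonzero polynomial cannot vanish on an infinite support. -/
theorem IsNontrivial.eq_zero_of_ip_self (hμ : IsNontrivial μ) {p : ℂ[X]} (h : ip μ p p = 0) :
    p = 0 := by
  rw [ip_self_eq_ofReal, Complex.ofReal_eq_zero,
    integral_eq_zero_iff_of_nonneg (fun _ => by positivity)
      (hμ.integrable_of_continuous (by fun_prop))] at h
  refine p.eq_zero_of_infinite_isRoot (hμ.infinite_of_isClosed (t := {x | p.IsRoot x})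
    (isClosed_singleton.preimage p.continuous) ?_)
  filter_upwards [h] with ζ hζ
  simpa using hζ

theorem IsNontrivial.normSq_pos (hμ : IsNontrivial μ) {p : ℂ[X]} (hp : p ≠ 0) :
    0 < ∫ ζ, ‖p.eval ζ‖ ^ 2 ∂μ := by
  refine lt_of_le_of_ne (integral_nonneg fun _ => by positivity) fun h => hp ?_
  exact hμ.eq_zero_of_ip_self (by rw [ip_self_eq_ofReal, ← h, Complex.ofReal_zero])

theorem IsNontrivial.ip_self_ne_zero (hμ : IsNontrivial μ) {p : ℂ[X]} (hp : p ≠ 0) :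
    ip μ p p ≠ 0 := fun h => hp (hμ.eq_zero_of_ip_self h)

theorem IsNontrivial.real_univ_pos (hμ : IsNontrivial μ) : 0 < μ.real Set.univ := by
  simpa using hμ.normSq_pos (one_ne_zero : (1 : ℂ[X]) ≠ 0)

/-! ### The conjugate reversal in degree `n` -/

/-- The conjugate reversal `z ^ n * conj (p (1 / conj z))` of a polynomial of degree at most `n`;
the nominal degree `n` is a parameter, so that this is additive in `p`. -/
noncomputable def rev (n : ℕ) (p : ℂ[X]) : ℂ[X] := (p.map (starRingEnd ℂ)).reflect n

theorem coeff_rev_zero (n : ℕ) (p : ℂ[X]) : (rev n p).coeff 0 = conj (p.coeff n) := by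
  simp [rev, coeff_reflect]

theorem natDegree_rev_le {n : ℕ} {p : ℂ[X]} (hp : p.natDegree ≤ n) :
    (rev n p).natDegree ≤ n :=
  (natDegree_reflect_le).trans (by simp [natDegree_map, hp])

theorem eval_rev {n : ℕ} {p : ℂ[X]} (hp : p.natDegree ≤ n) {ζ : ℂ} (hζ : ‖ζ‖ = 1) :
    (rev n p).eval ζ = ζ ^ n * conj (p.eval ζ) := by
  have h1 : ζ * conj ζ = 1 := by simp [Complex.mul_conj', hζ]
  let _ : Invertible (conj ζ) := ⟨ζ, h1, by rw [mul_comm, h1]⟩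
  have h := eval₂_reflect_mul_pow (RingHom.id ℂ) (conj ζ) n (p.map (starRingEnd ℂ))
    (by rwa [natDegree_map])
  have h2 : ⅟(conj ζ) = ζ := rfl
  rw [h2, ← eval, ← eval, eval_map_apply] at h
  rw [← h, rev, mul_left_comm, ← mul_pow, h1, one_pow, mul_one]

theorem eval_one_rev {n : ℕ} {p : ℂ[X]} (hp : p.natDegree ≤ n) :
    (rev n p).eval 1 = conj (p.eval 1) := by
  simpa using eval_rev hp (ζ := 1) (by simp)

theorem IsNontrivial.ip_rev_left (hμ : IsNontrivial μ) {n : ℕ} {p q : ℂ[X]}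
    (hp : p.natDegree ≤ n) (hq : q.natDegree ≤ n) : ip μ (rev n p) q = ip μ (rev n q) p := by
  refine integral_congr_ae ?_
  filter_upwards [hμ.ae_norm_eq_one] with ζ hζ
  simp only [eval_rev hp hζ, eval_rev hq hζ, map_mul, Complex.conj_conj]
  ring

theorem IsNontrivial.ip_rev_rev (hμ : IsNontrivial μ) {n : ℕ} {p q : ℂ[X]}
    (hp : p.natDegree ≤ n) (hq : q.natDegree ≤ n) : ip μ (rev n p) (rev n q) = ip μ q p := by
  refine integral_congr_ae ?_
  filter_upwards [hμ.ae_norm_eq_one] with ζ hζ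
  have h : conj (ζ ^ n) * ζ ^ n = 1 := by rw [Complex.conj_mul']; simp [hζ]
  simp only [eval_rev hp hζ, eval_rev hq hζ, map_mul, Complex.conj_conj]
  linear_combination (conj (q.eval ζ) * p.eval ζ) * h

theorem IsNontrivial.ip_rev_succ_X_mul (hμ : IsNontrivial μ) {n : ℕ} {p q : ℂ[X]}
    (hp : p.natDegree ≤ n + 1) (hq : q.natDegree ≤ n) :
    ip μ (rev (n + 1) p) (X * q) = ip μ (rev n q) p := by
  refine integral_congr_ae ?_
  filter_upwards [hμ.ae_norm_eq_one] with ζ hζ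
  have h : conj ζ * ζ = 1 := by rw [Complex.conj_mul']; simp [hζ]
  simp only [eval_rev hp hζ, eval_rev hq hζ, map_mul, Complex.conj_conj, eval_mul, eval_X,
    map_pow, pow_succ]
  linear_combination (conj ζ ^ n * q.eval ζ * p.eval ζ) * h

theorem reversed_eq_rev (q : ℂ[X]) : reversed q = rev q.natDegree q := by
  rw [reversed, rev, reverse, natDegree_map]

/-! ### Monic orthogonal polynomials and the Szegő recursion -/

theorem natDegree_monicOP_and_monic (μ : Measure ℂ) (n : ℕ) :
    (monicOP μ n).natDegree = n ∧ (monicOP μ n).Monic := by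
  induction n using Nat.strong_induction_on with
  | _ n ih =>
    rw [monicOP]
    have h : (∑ k : Fin n, C (ip μ (monicOP μ k.val) (X ^ n) /
        ip μ (monicOP μ k.val) (monicOP μ k.val)) * monicOP μ k.val).degree < (n : ℕ) := by
      rw [← mem_degreeLT]
      refine Submodule.sum_mem _ fun k _ => ?_
      rw [← smul_eq_C_mul]
      refine Submodule.smul_mem _ _ (mem_degreeLT.2 ?_)
      rw [degree_eq_natDegree (ih k k.isLt).2.ne_zero, (ih k k.isLt).1]
      exact_mod_cast k.isLt
    have hm := monic_X_pow_sub (n := n) (p := ∑ k : Fin n, C (ip μ (monicOP μ k.val) (X ^ n) /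
        ip μ (monicOP μ k.val) (monicOP μ k.val)) * monicOP μ k.val)
    refine ⟨natDegree_eq_of_degree_eq_some ?_, ?_⟩
    · rw [degree_sub_eq_left_of_degree_lt (by rwa [degree_X_pow]), degree_X_pow]
    · rw [sub_eq_add_neg]
      exact monic_X_pow_add (by rwa [degree_neg])

theorem natDegree_monicOP (μ : Measure ℂ) (n : ℕ) : (monicOP μ n).natDegree = n :=
  (natDegree_monicOP_and_monic μ n).1

theorem monic_monicOP (μ : Measure ℂ) (n : ℕ) : (monicOP μ n).Monic :=
  (natDegree_monicOP_and_monic μ n).2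

theorem coeff_monicOP_self (μ : Measure ℂ) (n : ℕ) : (monicOP μ n).coeff n = 1 := by
  simpa [natDegree_monicOP] using (monic_monicOP μ n).coeff_natDegree

theorem monicOP_zero (μ : Measure ℂ) : monicOP μ 0 = 1 := by
  rw [monicOP]; simp

theorem natDegree_sub_monicOP_lt {n : ℕ} {p : ℂ[X]} (hp : p.natDegree ≤ n + 1) :
    (p - C (p.coeff (n + 1)) * monicOP μ (n + 1)).natDegree ≤ n := by
  rw [natDegree_le_iff_coeff_eq_zero]
  intro k hk
  rcases (Nat.succ_le_of_lt hk).eq_or_lt with rfl | hk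
  · simp [coeff_monicOP_self]
  · rw [coeff_sub, coeff_C_mul, coeff_eq_zero_of_natDegree_lt (hp.trans_lt hk),
      coeff_eq_zero_of_natDegree_lt (p := monicOP μ (n + 1)) (by rwa [natDegree_monicOP])]
    simp

/-- A linear condition that holds for `Φ_0, …, Φ_n` holds for every polynomial of degree at
most `n`. -/
theorem induction_monicOP (μ : Measure ℂ) {M : ℂ[X] → Prop} {n : ℕ}
    (hadd : ∀ p q, M p → M q → M (p + q)) (hmul : ∀ a p, M p → M (C a * p))
    (h : ∀ k ≤ n, M (monicOP μ k)) {p : ℂ[X]} (hp : p.natDegree ≤ n) : M p := by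
  induction n generalizing p with
  | zero =>
    rw [eq_C_of_natDegree_le_zero hp, ← mul_one (C _), ← monicOP_zero μ]
    exact hmul _ _ (h 0 le_rfl)
  | succ n ih =>
    rw [← sub_add_cancel p (C (p.coeff (n + 1)) * monicOP μ (n + 1))]
    exact hadd _ _ (ih (fun k hk => h k (by omega)) (natDegree_sub_monicOP_lt hp))
      (hmul _ _ (h _ le_rfl))

theorem IsNontrivial.ip_monicOP_monicOP (hμ : IsNontrivial μ) {k n : ℕ} (hk : k < n) :
    ip μ (monicOP μ k) (monicOP μ n) = 0 := by
  induction n using Nat.strong_induction_on generalizing k with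
  | _ n ih =>
    nth_rw 2 [monicOP]
    rw [hμ.ip_sub_right, hμ.ip_sum_right, Finset.sum_eq_single (⟨k, hk⟩ : Fin n)]
    · rw [ip_C_mul_right, div_mul_cancel₀ _ (hμ.ip_self_ne_zero (monic_monicOP μ k).ne_zero),
        sub_self]
    · intro j _ hj
      have hjk : j.val ≠ k := fun h => hj (Fin.ext h)
      rw [ip_C_mul_right]
      rcases lt_or_gt_of_ne hjk with h | h
      · rw [ip_eq_zero_symm (ih k hk h), mul_zero]
      · rw [ih j j.isLt h, mul_zero]
    · simp

theorem IsNontrivial.ip_monicOP_eq_zero (hμ : IsNontrivial μ) {n : ℕ} {p : ℂ[X]}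
    (hp : p.natDegree < n) : ip μ (monicOP μ n) p = 0 := by
  obtain ⟨n, rfl⟩ : ∃ k, n = k + 1 := ⟨n - 1, by omega⟩
  refine induction_monicOP μ (M := fun p => ip μ (monicOP μ (n + 1)) p = 0) (n := n)
    (fun p q h h' => by rw [hμ.ip_add_right, h, h', add_zero])
    (fun a p h => by rw [ip_C_mul_right, h, mul_zero])
    (fun k hk => ip_eq_zero_symm (hμ.ip_monicOP_monicOP (by omega))) (by omega)

theorem IsNontrivial.ip_rev_monicOP_X_mul (hμ : IsNontrivial μ) {n : ℕ} {q : ℂ[X]}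
    (hq : q.natDegree < n) : ip μ (rev n (monicOP μ n)) (X * q) = 0 := by
  obtain ⟨n, rfl⟩ : ∃ k, n = k + 1 := ⟨n - 1, by omega⟩
  have hqn : q.natDegree ≤ n := by omega
  rw [hμ.ip_rev_succ_X_mul (natDegree_monicOP μ _).le hqn]
  exact ip_eq_zero_symm (hμ.ip_monicOP_eq_zero ((natDegree_rev_le hqn).trans_lt (by omega)))

/-- A polynomial of degree at most `n` orthogonal to `z, …, z ^ n` is a multiple of the reversed
orthogonal polynomial `Φ_n*`. -/
theorem IsNontrivial.eq_C_mul_rev_monicOP (hμ : IsNontrivial μ) {n : ℕ} {D : ℂ[X]}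
    (hD : D.natDegree ≤ n) (h : ∀ q : ℂ[X], q.natDegree < n → ip μ D (X * q) = 0) :
    D = C (D.coeff 0) * rev n (monicOP μ n) := by
  set E := D - C (D.coeff 0) * rev n (monicOP μ n) with hE
  have hE0 : E.coeff 0 = 0 := by
    simp [hE, coeff_rev_zero, coeff_monicOP_self]
  have hEd : E.natDegree ≤ n :=
    (natDegree_sub_le _ _).trans (max_le hD ((natDegree_C_mul_le _ _).trans
      (natDegree_rev_le (natDegree_monicOP μ n).le)))
  obtain ⟨q, hq⟩ := X_dvd_iff.2 hE0
  suffices hEz : E = 0 from sub_eq_zero.1 hEz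
  by_contra hne
  have hq0 : q ≠ 0 := fun h0 => hne (by rw [hq, h0, mul_zero])
  have hqd : q.natDegree < n := by
    rw [hq, natDegree_X_mul hq0] at hEd
    omega
  refine hne (hμ.eq_zero_of_ip_self ?_)
  nth_rw 2 [hq]
  rw [hE, hμ.ip_sub_left, ip_C_mul_left, h q hqd, hμ.ip_rev_monicOP_X_mul hqd]
  simp

theorem conj_verblunsky (μ : Measure ℂ) (n : ℕ) :
    conj (verblunsky μ n) = -(monicOP μ (n + 1)).coeff 0 := by
  simp [verblunsky, coeff_zero_eq_eval_zero]

/-- The Szegő recursion. -/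
theorem IsNontrivial.monicOP_succ (hμ : IsNontrivial μ) (n : ℕ) :
    monicOP μ (n + 1) =
      X * monicOP μ n - C (conj (verblunsky μ n)) * rev n (monicOP μ n) := by
  have h := hμ.eq_C_mul_rev_monicOP (n := n) (D := monicOP μ (n + 1) - X * monicOP μ n) ?_ ?_
  · rw [coeff_sub, mul_coeff_zero, coeff_X_zero, zero_mul, sub_zero] at h
    rw [conj_verblunsky, C_neg, neg_mul, sub_neg_eq_add, ← h]
    ring
  · rw [natDegree_le_iff_coeff_eq_zero]
    intro k hk
    obtain ⟨k, rfl⟩ : ∃ j, k = j + 1 := ⟨k - 1, by omega⟩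
    rw [coeff_sub, coeff_X_mul]
    rcases (Nat.succ_le_of_lt hk).eq_or_lt with h | h
    · obtain rfl : n = k := by omega
      simp [coeff_monicOP_self]
    · rw [coeff_eq_zero_of_natDegree_lt (by rw [natDegree_monicOP]; omega),
        coeff_eq_zero_of_natDegree_lt (by rw [natDegree_monicOP]; omega), sub_zero]
  · intro q hq
    rw [hμ.ip_sub_left, hμ.ip_X_mul_X_mul, hμ.ip_monicOP_eq_zero hq,
      hμ.ip_monicOP_eq_zero ((natDegree_mul_le.trans
        (by rw [natDegree_X, add_comm])).trans_lt (by omega)), sub_zero]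

/-- The squared norm of the monic orthogonal polynomial of degree `n`. -/
noncomputable def normSqOP (μ : Measure ℂ) (n : ℕ) : ℝ := ∫ ζ, ‖(monicOP μ n).eval ζ‖ ^ 2 ∂μ

theorem ip_monicOP_self (μ : Measure ℂ) (n : ℕ) :
    ip μ (monicOP μ n) (monicOP μ n) = normSqOP μ n := ip_self_eq_ofReal _

theorem IsNontrivial.normSqOP_pos (hμ : IsNontrivial μ) (n : ℕ) : 0 < normSqOP μ n :=
  hμ.normSq_pos (monic_monicOP μ n).ne_zero

theorem normSqOP_zero (μ : Measure ℂ) : normSqOP μ 0 = μ.real Set.univ := by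
  simp [normSqOP, monicOP_zero]

theorem IsNontrivial.normSqOP_succ (hμ : IsNontrivial μ) (n : ℕ) :
    normSqOP μ (n + 1) = (1 - ‖verblunsky μ n‖ ^ 2) * normSqOP μ n := by
  set α := verblunsky μ n
  have hd := (natDegree_monicOP μ n).le
  have h0 : ip μ (monicOP μ (n + 1)) (rev n (monicOP μ n)) = 0 :=
    hμ.ip_monicOP_eq_zero ((natDegree_rev_le hd).trans_lt (by omega))
  have h1 : X * monicOP μ n = monicOP μ (n + 1) + C (conj α) * rev n (monicOP μ n) := by
    rw [hμ.monicOP_succ]; ring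
  have h2 := ip_monicOP_self μ n
  rw [← hμ.ip_X_mul_X_mul, h1, hμ.ip_add_right, hμ.ip_add_left, hμ.ip_add_left, ip_C_mul_right,
    ip_C_mul_left, ip_C_mul_left, ip_C_mul_right, h0, ip_eq_zero_symm h0, hμ.ip_rev_rev hd hd,
    ip_monicOP_self, ip_monicOP_self, Complex.conj_conj, ← mul_assoc, Complex.mul_conj'] at h2
  have h3 : normSqOP μ (n + 1) + ‖α‖ ^ 2 * normSqOP μ n = normSqOP μ n := by
    have h4 : ((normSqOP μ (n + 1) + ‖α‖ ^ 2 * normSqOP μ n : ℝ) : ℂ) = normSqOP μ n := by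
      push_cast
      linear_combination h2
    exact_mod_cast h4
  linear_combination h3

theorem IsNontrivial.one_sub_normSq_verblunsky_pos (hμ : IsNontrivial μ) (n : ℕ) :
    0 < 1 - ‖verblunsky μ n‖ ^ 2 := by
  have h := hμ.normSqOP_succ n
  exact pos_of_mul_pos_left (h ▸ hμ.normSqOP_pos (n + 1)) (hμ.normSqOP_pos n).le

theorem reversed_monicOP_eval_one (μ : Measure ℂ) (n : ℕ) :
    (reversed (monicOP μ n)).eval 1 = conj ((monicOP μ n).eval 1) := by
  rw [reversed_eq_rev, eval_one_rev le_rfl]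

theorem norm_tau_le_one (μ : Measure ℂ) (n : ℕ) : ‖tau μ n‖ ≤ 1 := by
  rw [tau, reversed_monicOP_eval_one, norm_div, RCLike.norm_conj]
  exact div_self_le_one _

theorem norm_tau_eq_one {n : ℕ} (h : (monicOP μ n).eval 1 ≠ 0) : ‖tau μ n‖ = 1 := by
  rw [tau, reversed_monicOP_eval_one, norm_div, RCLike.norm_conj, div_self (norm_ne_zero_iff.2 h)]

theorem IsNontrivial.norm_tau_mul_verblunsky_lt_one (hμ : IsNontrivial μ) (n : ℕ) :
    ‖tau μ n * verblunsky μ n‖ < 1 := by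
  have h := hμ.one_sub_normSq_verblunsky_pos n
  have h1 : ‖verblunsky μ n‖ < 1 := by nlinarith [norm_nonneg (verblunsky μ n)]
  rw [norm_mul]
  exact (mul_le_of_le_one_left (norm_nonneg _) (norm_tau_le_one μ n)).trans_lt h1

theorem IsNontrivial.re_tau_mul_verblunsky_lt_one (hμ : IsNontrivial μ) (n : ℕ) :
    (tau μ n * verblunsky μ n).re < 1 :=
  (Complex.re_le_norm _).trans_lt (hμ.norm_tau_mul_verblunsky_lt_one n)

theorem IsNontrivial.conj_monicOP_succ_eval_one (hμ : IsNontrivial μ) {n : ℕ}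
    (h : (monicOP μ n).eval 1 ≠ 0) :
    conj ((monicOP μ (n + 1)).eval 1) =
      (1 - tau μ n * verblunsky μ n) * conj ((monicOP μ n).eval 1) := by
  have h' : conj ((monicOP μ n).eval 1) ≠ 0 := by simpa using h
  rw [hμ.monicOP_succ, tau, reversed_monicOP_eval_one]
  simp only [eval_sub, eval_mul, eval_X, eval_C, one_mul,
    eval_one_rev (natDegree_monicOP μ n).le, map_sub, map_mul, Complex.conj_conj]
  field_simp

theorem IsNontrivial.monicOP_eval_one_ne_zero (hμ : IsNontrivial μ) (n : ℕ) :
    (monicOP μ n).eval 1 ≠ 0 := by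
  induction n with
  | zero => simp [monicOP_zero]
  | succ n ih =>
    intro h
    have h1 := hμ.conj_monicOP_succ_eval_one ih
    rw [h, map_zero, eq_comm, mul_eq_zero] at h1
    rcases h1 with h1 | h1
    · have := hμ.re_tau_mul_verblunsky_lt_one n
      rw [← sub_eq_zero.1 h1] at this
      simp at this
    · exact ih (by simpa using h1)

theorem IsNontrivial.two_mul_one_sub_g (hμ : IsNontrivial μ) (n : ℕ) :
    2 * (1 - g μ (n + 1)) =
      (1 - ‖verblunsky μ n‖ ^ 2) / (1 - (tau μ n * verblunsky μ n).re) := by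
  have h1 : 1 - (tau μ n * verblunsky μ n).re ≠ 0 :=
    (sub_pos.2 (hμ.re_tau_mul_verblunsky_lt_one n)).ne'
  have h2 : ‖verblunsky μ n‖ ^ 2 =
      (tau μ n * verblunsky μ n).re ^ 2 + (tau μ n * verblunsky μ n).im ^ 2 := by
    have h3 : ‖verblunsky μ n‖ = ‖tau μ n * verblunsky μ n‖ := by
      rw [norm_mul, norm_tau_eq_one (hμ.monicOP_eval_one_ne_zero n), one_mul]
    rw [h3, Complex.sq_norm, Complex.normSq_apply]
    ring
  rw [g, Nat.add_sub_cancel, h2, Complex.sq_norm, Complex.normSq_apply]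
  simp only [Complex.sub_re, Complex.one_re, Complex.sub_im, Complex.one_im]
  field_simp
  ring

theorem IsNontrivial.one_add_I_mul_c (hμ : IsNontrivial μ) (n : ℕ) :
    1 + Complex.I * (c μ (n + 1) : ℂ) =
      (1 - tau μ n * verblunsky μ n) / ((1 - (tau μ n * verblunsky μ n).re : ℝ) : ℂ) := by
  have h1 : 1 - (tau μ n * verblunsky μ n).re ≠ 0 :=
    (sub_pos.2 (hμ.re_tau_mul_verblunsky_lt_one n)).ne'
  have h2 : (tau μ n * verblunsky μ n).re - 1 ≠ 0 := by
    rw [← neg_ne_zero, neg_sub]; exact h1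
  rw [c, Nat.add_sub_cancel, eq_div_iff (by exact_mod_cast h1)]
  generalize tau μ n * verblunsky μ n = u at *
  have h3 : u.im / (u.re - 1) * (1 - u.re) = -u.im := by
    rw [← neg_sub u.re 1]
    field_simp
  have h4 : ((u.im / (u.re - 1) : ℝ) : ℂ) * ((1 - u.re : ℝ) : ℂ) = ((-u.im : ℝ) : ℂ) := by
    rw [← Complex.ofReal_mul, h3]
  rw [add_mul, mul_assoc, h4]
  apply Complex.ext <;> simp

theorem xi_succ (μ : Measure ℂ) (n : ℕ) : xi μ (n + 1) = xi μ n * (2 * (1 - g μ (n + 1))) := by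
  rw [xi, xi, Finset.prod_Icc_succ_top (by omega), mul_assoc]

theorem IsNontrivial.xi_pos (hμ : IsNontrivial μ) (n : ℕ) : 0 < xi μ n := by
  induction n with
  | zero => simpa [xi] using hμ.real_univ_pos
  | succ n ih =>
    rw [xi_succ, hμ.two_mul_one_sub_g]
    exact mul_pos ih (div_pos (hμ.one_sub_normSq_verblunsky_pos n)
      (sub_pos.2 (hμ.re_tau_mul_verblunsky_lt_one n)))

/-! ### The kernels `K_n(·, 1)` and `R_n` -/

theorem IsNontrivial.cdKernel_one_eq (hμ : IsNontrivial μ) (n : ℕ) :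
    cdKernel μ n 1 = ∑ j ∈ Finset.range (n + 1),
      C (conj ((monicOP μ j).eval 1) / (normSqOP μ j : ℂ)) * monicOP μ j := by
  refine Finset.sum_congr rfl fun j _ => ?_
  have h : ((Real.sqrt (normSqOP μ j))⁻¹ : ℝ) * ((Real.sqrt (normSqOP μ j))⁻¹ : ℝ) =
      (normSqOP μ j)⁻¹ := by
    rw [← mul_inv, Real.mul_self_sqrt (hμ.normSqOP_pos j).le]
  have h' := congrArg (fun x : ℝ => (x : ℂ)) h
  simp only [Complex.ofReal_mul] at h'
  rw [orthonormalOP, ← normSqOP, eval_mul, eval_C, map_mul, Complex.conj_ofReal, ← mul_assoc,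
    ← C_mul, mul_right_comm, h', div_eq_mul_inv, mul_comm (Complex.ofReal _), Complex.ofReal_inv]

theorem natDegree_cdKernel_le (μ : Measure ℂ) (n : ℕ) (w : ℂ) :
    (cdKernel μ n w).natDegree ≤ n := by
  refine natDegree_sum_le_of_forall_le _ _ fun j hj => (natDegree_C_mul_le _ _).trans
    ((natDegree_C_mul_le _ _).trans ?_)
  rw [natDegree_monicOP]
  exact Nat.lt_succ_iff.1 (Finset.mem_range.1 hj)

theorem IsNontrivial.coeff_cdKernel_one (hμ : IsNontrivial μ) (n : ℕ) :
    (cdKernel μ n 1).coeff n = conj ((monicOP μ n).eval 1) / (normSqOP μ n : ℂ) := by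
  rw [hμ.cdKernel_one_eq, finsetSum_coeff, Finset.sum_range_succ, coeff_C_mul,
    coeff_monicOP_self, mul_one, add_eq_right]
  refine Finset.sum_eq_zero fun j hj => ?_
  rw [coeff_C_mul, coeff_eq_zero_of_natDegree_lt, mul_zero]
  rw [natDegree_monicOP]
  exact Finset.mem_range.1 hj

/-- The reproducing property of the Christoffel-Darboux kernel at the point `1`. -/
theorem IsNontrivial.ip_cdKernel (hμ : IsNontrivial μ) {n : ℕ} {p : ℂ[X]}
    (hp : p.natDegree ≤ n) : ip μ (cdKernel μ n 1) p = p.eval 1 := by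
  refine induction_monicOP μ (M := fun p => ip μ (cdKernel μ n 1) p = p.eval 1) (n := n)
    (fun p q h h' => by rw [hμ.ip_add_right, h, h', eval_add])
    (fun a p h => by rw [ip_C_mul_right, h, eval_mul, eval_C]) (fun k hk => ?_) hp
  rw [hμ.cdKernel_one_eq, ← conj_ip, hμ.ip_sum_right, Finset.sum_eq_single k]
  · have h : (normSqOP μ k : ℂ) ≠ 0 := by exact_mod_cast (hμ.normSqOP_pos k).ne'
    rw [ip_C_mul_right, ip_monicOP_self, div_mul_cancel₀ _ h, Complex.conj_conj]
  · intro j _ hj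
    rw [ip_C_mul_right]
    rcases lt_or_gt_of_ne hj with h | h
    · rw [ip_eq_zero_symm (hμ.ip_monicOP_monicOP h), mul_zero]
    · rw [hμ.ip_monicOP_monicOP h, mul_zero]
  · intro h
    exact absurd (Finset.mem_range.2 (by omega)) h

/-- A polynomial of degree at most `n` is determined by its inner products with the polynomials
of degree at most `n`. -/
theorem IsNontrivial.eq_of_forall_ip_eq (hμ : IsNontrivial μ) {n : ℕ} {p q : ℂ[X]}
    (hp : p.natDegree ≤ n) (hq : q.natDegree ≤ n)
    (h : ∀ r : ℂ[X], r.natDegree ≤ n → ip μ p r = ip μ q r) : p = q := by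
  refine sub_eq_zero.1 (hμ.eq_zero_of_ip_self ?_)
  rw [hμ.ip_sub_left, h _ ((natDegree_sub_le _ _).trans (max_le hp hq)), sub_self]

/-- The kernel `K_n(·, 1)` is self-reciprocal of degree `n`: its reversal has the same reproducing
property. -/
theorem IsNontrivial.rev_cdKernel (hμ : IsNontrivial μ) (n : ℕ) :
    rev n (cdKernel μ n 1) = cdKernel μ n 1 := by
  have hd := natDegree_cdKernel_le μ n 1
  refine hμ.eq_of_forall_ip_eq (natDegree_rev_le hd) hd fun r hr => ?_
  rw [hμ.ip_rev_left hd hr, ← conj_ip, hμ.ip_cdKernel (natDegree_rev_le hr), eval_one_rev hr,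
    Complex.conj_conj, hμ.ip_cdKernel hr]

theorem natDegree_R_le (μ : Measure ℂ) (n : ℕ) : (R μ n).natDegree ≤ n :=
  (natDegree_C_mul_le _ _).trans (natDegree_cdKernel_le μ n 1)

theorem IsNontrivial.ip_R (hμ : IsNontrivial μ) {n : ℕ} {p : ℂ[X]} (hp : p.natDegree ≤ n) :
    ip μ (R μ n) p = xi μ n * p.eval 1 := by
  rw [R, ip_C_mul_left, hμ.ip_cdKernel hp, Complex.conj_ofReal]

theorem IsNontrivial.coeff_R_self_eq (hμ : IsNontrivial μ) (n : ℕ) :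
    (R μ n).coeff n = xi μ n * (conj ((monicOP μ n).eval 1) / (normSqOP μ n : ℂ)) := by
  rw [R, coeff_C_mul, hμ.coeff_cdKernel_one]

theorem IsNontrivial.coeff_R_self_ne_zero (hμ : IsNontrivial μ) (n : ℕ) :
    (R μ n).coeff n ≠ 0 := by
  rw [hμ.coeff_R_self_eq]
  have h1 : (xi μ n : ℂ) ≠ 0 := by exact_mod_cast (hμ.xi_pos n).ne'
  have h2 : (normSqOP μ n : ℂ) ≠ 0 := by exact_mod_cast (hμ.normSqOP_pos n).ne'
  have h3 : conj ((monicOP μ n).eval 1) ≠ 0 := by simpa using hμ.monicOP_eval_one_ne_zero n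
  exact mul_ne_zero h1 (div_ne_zero h3 h2)

theorem IsNontrivial.coeff_R_succ (hμ : IsNontrivial μ) (n : ℕ) :
    (R μ (n + 1)).coeff (n + 1) = (1 + Complex.I * (c μ (n + 1) : ℂ)) * (R μ n).coeff n := by
  have h1 := (hμ.one_sub_normSq_verblunsky_pos n).ne'
  have h2 := (sub_pos.2 (hμ.re_tau_mul_verblunsky_lt_one n)).ne'
  have h3 := (hμ.normSqOP_pos n).ne'
  rw [hμ.coeff_R_self_eq, hμ.coeff_R_self_eq, hμ.one_add_I_mul_c, xi_succ, hμ.two_mul_one_sub_g,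
    hμ.normSqOP_succ, hμ.conj_monicOP_succ_eval_one (hμ.monicOP_eval_one_ne_zero n)]
  rw [← Complex.ofReal_ne_zero] at h1 h2 h3
  rw [Complex.ofReal_mul, Complex.ofReal_mul, Complex.ofReal_div]
  field_simp

theorem IsNontrivial.coeff_R_self (hμ : IsNontrivial μ) (n : ℕ) :
    (R μ n).coeff n = ∏ j ∈ Finset.Icc 1 n, (1 + Complex.I * (c μ j : ℂ)) := by
  induction n with
  | zero =>
    have h : (μ.real Set.univ : ℂ) ≠ 0 := by exact_mod_cast hμ.real_univ_pos.ne'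
    simp [hμ.coeff_R_self_eq, xi, monicOP_zero, normSqOP_zero, h]
  | succ n ih => rw [hμ.coeff_R_succ, ih, Finset.prod_Icc_succ_top (by omega), mul_comm]

theorem IsNontrivial.coeff_R_zero (hμ : IsNontrivial μ) (n : ℕ) :
    (R μ n).coeff 0 = conj ((R μ n).coeff n) := by
  have h : (cdKernel μ n 1).coeff 0 = conj ((cdKernel μ n 1).coeff n) := by
    rw [← coeff_rev_zero, hμ.rev_cdKernel]
  rw [R, coeff_C_mul, coeff_C_mul, h, map_mul, Complex.conj_ofReal]

theorem IsNontrivial.coeff_R_zero_ne_zero (hμ : IsNontrivial μ) (n : ℕ) :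
    (R μ n).coeff 0 ≠ 0 := by
  simpa [hμ.coeff_R_zero] using hμ.coeff_R_self_ne_zero n

theorem IsNontrivial.coeff_R_succ_zero (hμ : IsNontrivial μ) (n : ℕ) :
    (R μ (n + 1)).coeff 0 = (1 - Complex.I * (c μ (n + 1) : ℂ)) * (R μ n).coeff 0 := by
  rw [hμ.coeff_R_zero, hμ.coeff_R_zero, hμ.coeff_R_succ]
  simp [sub_eq_add_neg]

/-- `R_n` spans the polynomials of degree at most `n` orthogonal to `z ^ j * (z - 1)` for all
`j < n`. -/
theorem IsNontrivial.exists_eq_C_mul_R (hμ : IsNontrivial μ) {n : ℕ} {P : ℂ[X]}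
    (hP : P.natDegree ≤ n) (h : ∀ j < n, ip μ P (X ^ j * (X - 1)) = 0) :
    ∃ b : ℂ, P = C b * R μ n := by
  have hxi : (xi μ n : ℂ) ≠ 0 := by exact_mod_cast (hμ.xi_pos n).ne'
  have h1 : ∀ r : ℂ[X], r.natDegree < n → ip μ P (r * (X - 1)) = 0 := by
    intro r hr
    rw [r.as_sum_range_C_mul_X_pow' hr, Finset.sum_mul, hμ.ip_sum_right]
    refine Finset.sum_eq_zero fun j hj => ?_
    rw [mul_assoc, ip_C_mul_right, h j (Finset.mem_range.1 hj), mul_zero]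
  refine ⟨conj (ip μ P 1) / xi μ n, hμ.eq_of_forall_ip_eq hP
    ((natDegree_C_mul_le _ _).trans (natDegree_R_le μ n)) fun r hr => ?_⟩
  rw [ip_C_mul_left, hμ.ip_R hr, map_div₀, Complex.conj_conj, Complex.conj_ofReal, ← mul_assoc,
    div_mul_cancel₀ _ hxi]
  have h2 : r = C (r.eval 1) * 1 + (r /ₘ (X - C 1)) * (X - 1) := by
    conv_lhs => rw [← modByMonic_add_div r (X - C 1), modByMonic_X_sub_C_eq_C_eval]
    rw [C_1]; ring
  have h3 : ip μ P ((r /ₘ (X - C 1)) * (X - 1)) = 0 := by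
    rcases Nat.eq_zero_or_pos n with rfl | hn
    · rw [eq_C_of_natDegree_le_zero hr,
        (divByMonic_eq_zero_iff (monic_X_sub_C 1)).2
          (by rw [degree_X_sub_C]; exact degree_C_lt.trans_le (by simp)), zero_mul, ip_zero_right]
    · refine h1 _ ?_
      rw [natDegree_divByMonic _ (monic_X_sub_C 1), natDegree_X_sub_C]
      omega
  conv_lhs => rw [h2]
  rw [hμ.ip_add_right, ip_C_mul_right, h3, add_zero, mul_comm]

/-- By the reproducing property, `R_n` is orthogonal to the polynomials of degree at most `n` that
vanish at `1`. -/
theorem IsNontrivial.ip_X_pow_mul_R (hμ : IsNontrivial μ) {k i n : ℕ} (hk : k ≤ i)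
    (hi : i < k + n) : ip μ (X ^ k * R μ n) (X ^ i * (X - 1)) = 0 := by
  obtain ⟨j, rfl⟩ := Nat.exists_eq_add_of_le hk
  rw [pow_add, mul_assoc, hμ.ip_X_pow_mul_X_pow_mul, hμ.ip_R]
  · simp
  · refine natDegree_mul_le.trans ?_
    rw [natDegree_X_pow, ← C_1, natDegree_X_sub_C]
    omega

/-! ### Expansion in the polynomials `z ^ ⌊k / 2⌋ R_{N - k}` -/

/-- The polynomials `z ^ ⌊k / 2⌋ R_{N - k}`, `k ≤ 2 * m`, `N = n + 2 * m`, span the polynomials of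
degree at most `N` orthogonal to `z ^ i * (z - 1)` for `m ≤ i < m + n`. Only the first one has
a nonzero coefficient of `z ^ N`, of the others only the second one has a nonzero constant
coefficient, and the remaining ones are `z` times the family for `m - 1`. -/
theorem IsNontrivial.exists_eq_sum_R (hμ : IsNontrivial μ) (n m : ℕ) {P : ℂ[X]}
    (hP : P.natDegree ≤ n + 2 * m)
    (h : ∀ j < n, ip μ P (X ^ (m + j) * (X - 1)) = 0) :
    ∃ b : ℕ → ℂ, P =
      ∑ k ∈ Finset.range (2 * m + 1), C (b k) * X ^ (k / 2) * R μ (n + 2 * m - k) := by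
  induction m generalizing P with
  | zero =>
    obtain ⟨b, hb⟩ := hμ.exists_eq_C_mul_R hP (by simpa using h)
    exact ⟨fun _ => b, by simpa using hb⟩
  | succ m ih =>
    set N := n + 2 * m with hN
    have hN2 : n + 2 * (m + 1) = N + 2 := by omega
    rw [hN2] at hP ⊢
    -- `b₀` removes the top coefficient, then `b₁` the constant one
    set b₀ := P.coeff (N + 2) / (R μ (N + 2)).coeff (N + 2)
    set Q := P - C b₀ * R μ (N + 2) with hQ
    set b₁ := Q.coeff 0 / (R μ (N + 1)).coeff 0
    set S := Q - C b₁ * R μ (N + 1) with hS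
    have hQd : Q.natDegree ≤ N + 1 := by
      rw [natDegree_le_iff_coeff_eq_zero]
      intro k hk
      rcases (Nat.succ_le_of_lt hk).eq_or_lt with rfl | hk'
      · rw [hQ, coeff_sub, coeff_C_mul, div_mul_cancel₀ _ (hμ.coeff_R_self_ne_zero _), sub_self]
      · rw [hQ, coeff_sub, coeff_C_mul, coeff_eq_zero_of_natDegree_lt (by omega),
          coeff_eq_zero_of_natDegree_lt ((natDegree_R_le μ _).trans_lt (by omega)), mul_zero,
          sub_zero]
    have hSd : S.natDegree ≤ N + 1 := (natDegree_sub_le _ _).trans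
      (max_le hQd ((natDegree_C_mul_le _ _).trans (natDegree_R_le μ _)))
    have hS0 : S.coeff 0 = 0 := by
      rw [hS, coeff_sub, coeff_C_mul, div_mul_cancel₀ _ (hμ.coeff_R_zero_ne_zero _), sub_self]
    obtain ⟨T, hT⟩ := X_dvd_iff.2 hS0
    have hTd : T.natDegree ≤ N := by
      rcases eq_or_ne T 0 with rfl | hT0
      · simp
      · rw [hT, natDegree_X_mul hT0] at hSd
        omega
    obtain ⟨b, hb⟩ := ih hTd fun j hj => by
      have hR : ∀ k, N + 1 ≤ k → ip μ (R μ k) (X ^ (m + 1 + j) * (X - 1)) = 0 := fun k hk => by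
        simpa using hμ.ip_X_pow_mul_R (k := 0) (i := m + 1 + j) (n := k) (by omega) (by omega)
      rw [← hμ.ip_X_mul_X_mul, ← hT, ← mul_assoc, ← pow_succ',
        show m + j + 1 = m + 1 + j by omega, hS, hμ.ip_sub_left, ip_C_mul_left, hR _ le_rfl, hQ,
        hμ.ip_sub_left, ip_C_mul_left, hR _ (by omega), h j hj]
      simp
    refine ⟨fun k => if k = 0 then b₀ else if k = 1 then b₁ else b (k - 2), ?_⟩
    rw [show 2 * (m + 1) + 1 = 2 * m + 1 + 1 + 1 by omega, Finset.sum_range_succ',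
      Finset.sum_range_succ']
    have h1 : ∀ k, C (b k) * X ^ ((k + 1 + 1) / 2) * R μ (N + 2 - (k + 1 + 1)) =
        X * (C (b k) * X ^ (k / 2) * R μ (N - k)) := fun k => by
      rw [show (k + 1 + 1) / 2 = k / 2 + 1 by omega, show N + 2 - (k + 1 + 1) = N - k by omega]
      ring
    simp only [show ∀ k, ¬ k + 1 + 1 = 0 by omega,
      show ∀ k, ¬ k + 1 + 1 = 1 by omega, if_false, show ∀ k, k + 1 + 1 - 2 = k by omega, h1]
    rw [← Finset.mul_sum, ← hb, ← hT, hS, hQ]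
    simp

/-- The polynomials `z ^ ⌊k / 2⌋ R_{N - k}` are linearly independent. -/
theorem IsNontrivial.eq_zero_of_sum_R_eq_zero (hμ : IsNontrivial μ) (n m : ℕ) {b : ℕ → ℂ}
    (h : ∑ k ∈ Finset.range (2 * m + 1), C (b k) * X ^ (k / 2) * R μ (n + 2 * m - k) = 0) :
    ∀ k ∈ Finset.range (2 * m + 1), b k = 0 := by
  induction m generalizing b with
  | zero =>
    have h0 := congrArg (fun p => p.coeff n) h
    simpa [hμ.coeff_R_self_ne_zero] using h0
  | succ m ih =>
    set N := n + 2 * m with hN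
    have hN2 : n + 2 * (m + 1) = N + 2 := by omega
    have h1 : ∀ k, C (b (k + 1 + 1)) * X ^ ((k + 1 + 1) / 2) * R μ (N + 2 - (k + 1 + 1)) =
        X * (C (b (k + 1 + 1)) * X ^ (k / 2) * R μ (N - k)) := fun k => by
      rw [show (k + 1 + 1) / 2 = k / 2 + 1 by omega, show N + 2 - (k + 1 + 1) = N - k by omega]
      ring
    rw [hN2, show 2 * (m + 1) + 1 = 2 * m + 1 + 1 + 1 by omega, Finset.sum_range_succ',
      Finset.sum_range_succ'] at h
    simp only [h1, ← Finset.mul_sum] at h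
    norm_num at h
    set S := ∑ k ∈ Finset.range (2 * m + 1), C (b (k + 1 + 1)) * X ^ (k / 2) * R μ (N - k)
    have hSd : S.natDegree ≤ N := by
      refine natDegree_sum_le_of_forall_le _ _ fun k hk => ?_
      rw [mul_assoc]
      refine (natDegree_C_mul_le _ _).trans (natDegree_mul_le.trans ?_)
      have := natDegree_R_le μ (N - k)
      have := Finset.mem_range.1 hk
      rw [natDegree_X_pow]
      omega
    have hb0 : b 0 = 0 := by
      have h2 := congrArg (fun p => p.coeff (N + 2)) h
      simpa [coeff_X_mul, coeff_eq_zero_of_natDegree_lt (hSd.trans_lt (Nat.lt_succ_self _)),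
        coeff_eq_zero_of_natDegree_lt ((natDegree_R_le μ (N + 1)).trans_lt (Nat.lt_succ_self _)),
        hμ.coeff_R_self_ne_zero] using h2
    rw [hb0, C_0, zero_mul, add_zero] at h
    have hb1 : b 1 = 0 := by
      have h2 := congrArg (fun p => p.coeff 0) h
      simpa [hμ.coeff_R_zero_ne_zero] using h2
    rw [hb1, C_0, zero_mul, add_zero] at h
    have h3 := ih ((mul_eq_zero.1 h).resolve_left X_ne_zero)
    intro k hk
    rcases k with _ | _ | k
    · exact hb0
    · exact hb1
    · exact h3 k (Finset.mem_range.2 (by have := Finset.mem_range.1 hk; omega))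

/-! ### The Christoffel transform -/

theorem ip_christoffel (μ : Measure ℂ) (G p q : ℂ[X]) :
    ip (christoffel μ G) p q = ∫ ζ, (‖G.eval ζ‖ : ℂ) * (conj (p.eval ζ) * q.eval ζ) ∂μ := by
  rw [ip, christoffel, integral_withDensity_eq_integral_toReal_smul
    G.continuous.norm.measurable.ennreal_ofReal
    (Filter.Eventually.of_forall fun _ => ENNReal.ofReal_lt_top)]
  refine integral_congr_ae (Filter.Eventually.of_forall fun ζ => ?_)
  simp

theorem IsChristoffelFactor.ae_eval_eq {m : ℕ} {G : ℂ[X]} (hG : IsChristoffelFactor μ m G)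
    (hμ : IsNontrivial μ) : ∀ᵐ ζ ∂μ, G.eval ζ = ζ ^ m * (‖G.eval ζ‖ : ℂ) := by
  filter_upwards [hμ.ae_norm_eq_one, Measure.support_mem_ae (μ := μ)] with ζ hζ hs
  obtain ⟨r, hr, h⟩ := hG.nonneg ζ hs
  have h0 : ζ ^ m ≠ 0 := pow_ne_zero _ (norm_ne_zero_iff.1 (by rw [hζ]; exact one_ne_zero))
  have h1 : G.eval ζ = r * ζ ^ m := (div_eq_iff h0).1 h
  have h2 : ‖G.eval ζ‖ = r := by rw [h1]; simp [hζ, abs_of_nonneg hr]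
  rw [h2, h1, mul_comm]

theorem IsChristoffelFactor.ne_zero {m : ℕ} {G : ℂ[X]} (hG : IsChristoffelFactor μ m G)
    (hm : 1 ≤ m) : G ≠ 0 := by
  rintro rfl
  have := hG.natDegree_eq
  rw [natDegree_zero] at this
  omega

theorem IsChristoffelFactor.coeff_zero_eq {m : ℕ} {G : ℂ[X]} (hG : IsChristoffelFactor μ m G) :
    G.coeff 0 = conj (G.coeff (2 * m)) := by
  conv_lhs => rw [← hG.reversed_eq, reversed_eq_rev, hG.natDegree_eq, coeff_rev_zero]

theorem IsChristoffelFactor.coeff_two_mul_ne_zero {m : ℕ} {G : ℂ[X]}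
    (hG : IsChristoffelFactor μ m G) (hm : 1 ≤ m) : G.coeff (2 * m) ≠ 0 := by
  rw [← hG.natDegree_eq]
  exact leadingCoeff_ne_zero.2 (hG.ne_zero hm)

theorem IsNontrivial.christoffel (hμ : IsNontrivial μ) {G : ℂ[X]} (hG : G ≠ 0) :
    IsNontrivial (christoffel μ G) where
  finite := isFiniteMeasure_withDensity_ofReal
    (hμ.integrable_of_continuous G.continuous.norm).hasFiniteIntegral
  circle := withDensity_absolutelyContinuous _ _ hμ.circle
  infinite_support := by
    set s := (OPUC.christoffel μ G).support with hs
    have hroots : IsClosed {x | G.IsRoot x} := isClosed_singleton.preimage G.continuous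
    have h0 : μ ({ζ | ENNReal.ofReal ‖G.eval ζ‖ ≠ 0} ∩ sᶜ) = 0 :=
      (withDensity_apply_eq_zero G.continuous.norm.measurable.ennreal_ofReal).1
        (Measure.measure_compl_support (μ := OPUC.christoffel μ G))
    have h1 : (s ∪ {x | G.IsRoot x}).Infinite := by
      refine hμ.infinite_of_isClosed (Measure.isClosed_support.union hroots) ?_
      refine measure_mono_null (fun ζ hζ => ?_) h0
      have h2 : ¬ (ζ ∈ s ∨ G.IsRoot ζ) := hζ
      rw [not_or] at h2
      refine ⟨?_, h2.1⟩
      simpa using h2.2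
    exact fun h => h1 (h.union (finite_setOfPred_isRoot hG))

/-- Multiplication by `G` turns the inner product of the transformed measure into that of `μ`, up
to the shift by `z ^ m`. -/
theorem IsChristoffelFactor.ip_mul_X_pow_mul {m : ℕ} {G : ℂ[X]}
    (hG : IsChristoffelFactor μ m G) (hμ : IsNontrivial μ) (p q : ℂ[X]) :
    ip μ (G * p) (X ^ m * q) = ip (OPUC.christoffel μ G) p q := by
  rw [ip_christoffel]
  refine integral_congr_ae ?_
  filter_upwards [hμ.ae_norm_eq_one, hG.ae_eval_eq hμ] with ζ hζ h
  have h1 : conj (ζ ^ m) * ζ ^ m = 1 := by rw [Complex.conj_mul']; simp [hζ]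
  have h2 : conj (G.eval ζ) = conj (ζ ^ m) * (‖G.eval ζ‖ : ℂ) := by
    conv_lhs => rw [h, map_mul, Complex.conj_ofReal]
  rw [eval_mul, eval_mul, eval_pow, eval_X, map_mul, h2]
  linear_combination ((‖G.eval ζ‖ : ℂ) * conj (p.eval ζ) * q.eval ζ) * h1

/-! ### The connection formula -/

theorem sum_range_two_mul_add_one {M : Type*} [AddCommMonoid M] (f : ℕ → M) (m : ℕ) :
    ∑ k ∈ Finset.range (2 * m + 1), f k =
      f 0 + ∑ j ∈ Finset.Icc 1 m, f (2 * j - 1) + ∑ j ∈ Finset.Icc 1 m, f (2 * j) := by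
  induction m with
  | zero => simp
  | succ m ih =>
    rw [show 2 * (m + 1) + 1 = 2 * m + 1 + 1 + 1 by omega, Finset.sum_range_succ,
      Finset.sum_range_succ, ih, Finset.sum_Icc_succ_top (by omega),
      Finset.sum_Icc_succ_top (by omega), show 2 * (m + 1) - 1 = 2 * m + 1 by omega,
      show 2 * (m + 1) = 2 * m + 1 + 1 by omega]
    abel

/-- The coefficient sequence `1, a₁, a₂, …` of the right-hand side of the connection formula. -/
def consOne (a : ℕ → ℂ) (k : ℕ) : ℂ := if k = 0 then 1 else a k

theorem connectionFormula_iff {m n : ℕ} {G : ℂ[X]} {γ : ℂ} {a : ℕ → ℂ} :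
    ConnectionFormula μ m G n γ a ↔ C γ * (G * R (OPUC.christoffel μ G) n) =
      ∑ k ∈ Finset.range (2 * m + 1),
        C (consOne a k) * X ^ (k / 2) * R μ (n + 2 * m - k) := by
  rw [ConnectionFormula, sum_range_two_mul_add_one, mul_assoc]
  have h1 : ∀ j ∈ Finset.Icc 1 m,
      C (consOne a (2 * j - 1)) * X ^ ((2 * j - 1) / 2) * R μ (n + 2 * m - (2 * j - 1)) =
        C (a (2 * j - 1)) * X ^ (j - 1) * R μ (n + 2 * m - 2 * j + 1) := fun j hj => by
    have := Finset.mem_Icc.1 hj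
    rw [consOne, if_neg (by omega), show (2 * j - 1) / 2 = j - 1 by omega,
      show n + 2 * m - (2 * j - 1) = n + 2 * m - 2 * j + 1 by omega]
  have h2 : ∀ j ∈ Finset.Icc 1 m,
      C (consOne a (2 * j)) * X ^ (2 * j / 2) * R μ (n + 2 * m - 2 * j) =
        C (a (2 * j)) * X ^ j * R μ (n + 2 * m - 2 * j) := fun j hj => by
    have := Finset.mem_Icc.1 hj
    rw [consOne, if_neg (by omega), show 2 * j / 2 = j by omega]
  rw [Finset.sum_congr rfl h1, Finset.sum_congr rfl h2]
  simp [consOne]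

/-- Only `k = 0` contributes to the coefficient of `z ^ N`. -/
theorem coeff_sum_R (μ : Measure ℂ) (m n : ℕ) (b : ℕ → ℂ) :
    (∑ k ∈ Finset.range (2 * m + 1), C (b k) * X ^ (k / 2) * R μ (n + 2 * m - k)).coeff
      (n + 2 * m) = b 0 * (R μ (n + 2 * m)).coeff (n + 2 * m) := by
  rw [Finset.sum_range_succ', coeff_add, finsetSum_coeff, Finset.sum_eq_zero, zero_add]
  · simp
  · intro k hk
    rw [Finset.mem_range] at hk
    refine coeff_eq_zero_of_natDegree_lt ?_
    rw [mul_assoc]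
    refine (natDegree_C_mul_le _ _).trans_lt (natDegree_mul_le.trans_lt ?_)
    have := natDegree_R_le μ (n + 2 * m - (k + 1))
    rw [natDegree_X_pow]
    omega

/-- Only `k = 0` and `k = 1` contribute to the constant coefficient. -/
theorem coeff_zero_sum_R (μ : Measure ℂ) {m : ℕ} (hm : 1 ≤ m) (n : ℕ) (b : ℕ → ℂ) :
    (∑ k ∈ Finset.range (2 * m + 1), C (b k) * X ^ (k / 2) * R μ (n + 2 * m - k)).coeff 0 =
      b 0 * (R μ (n + 2 * m)).coeff 0 + b 1 * (R μ (n + 2 * m - 1)).coeff 0 := by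
  obtain ⟨m, rfl⟩ : ∃ k, m = k + 1 := ⟨m - 1, by omega⟩
  rw [show 2 * (m + 1) + 1 = 2 * m + 1 + 1 + 1 by omega, Finset.sum_range_succ',
    Finset.sum_range_succ', coeff_add, coeff_add, finsetSum_coeff, Finset.sum_eq_zero, zero_add]
  · simp [mul_coeff_zero, add_comm]
  · intro k _
    rw [show (k + 1 + 1) / 2 = k / 2 + 1 by omega]
    simp [mul_coeff_zero]

variable {m : ℕ} {G : ℂ[X]}

/-- Comparison of the coefficients of `z ^ (n + 2 * m)`. -/
theorem IsChristoffelFactor.coeff_top_of_eq_sum (hG : IsChristoffelFactor μ m G) {n : ℕ} {γ : ℂ}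
    {b : ℕ → ℂ} (h : C γ * (G * R (OPUC.christoffel μ G) n) =
      ∑ k ∈ Finset.range (2 * m + 1), C (b k) * X ^ (k / 2) * R μ (n + 2 * m - k)) :
    γ * (G.coeff (2 * m) * (R (OPUC.christoffel μ G) n).coeff n) =
      b 0 * (R μ (n + 2 * m)).coeff (n + 2 * m) := by
  have h1 := congrArg (fun p => p.coeff (n + 2 * m)) h
  simp only [coeff_sum_R, coeff_C_mul] at h1
  rwa [add_comm n (2 * m), coeff_mul_add_eq_of_natDegree_le hG.natDegree_eq.le
    (natDegree_R_le _ n), add_comm (2 * m) n] at h1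

/-- Pairing with `z ^ m`. -/
theorem IsChristoffelFactor.xi_of_eq_sum (hG : IsChristoffelFactor μ m G) (hμ : IsNontrivial μ)
    (hm : 1 ≤ m) {n : ℕ} {γ : ℂ} {b : ℕ → ℂ} (h : C γ * (G * R (OPUC.christoffel μ G) n) =
      ∑ k ∈ Finset.range (2 * m + 1), C (b k) * X ^ (k / 2) * R μ (n + 2 * m - k)) :
    γ * (xi (OPUC.christoffel μ G) n : ℂ) =
      ∑ k ∈ Finset.range (2 * m + 1), b k * (xi μ (n + 2 * m - k) : ℂ) := by
  have h1 := congrArg (fun p => ip μ (X ^ m * 1) p) h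
  simp only [hμ.ip_sum_right, ip_C_mul_right, mul_assoc] at h1
  rw [← conj_ip (μ := μ) (G * _), hG.ip_mul_X_pow_mul hμ,
    (hμ.christoffel (hG.ne_zero hm)).ip_R (by simp), eval_one, mul_one, Complex.conj_ofReal] at h1
  rw [h1]
  refine Finset.sum_congr rfl fun k hk => ?_
  rw [Finset.mem_range] at hk
  obtain ⟨i, hi⟩ : ∃ i, m = k / 2 + i := ⟨m - k / 2, by omega⟩
  have h2 : ip μ (X ^ (k / 2) * R μ (n + 2 * m - k)) (X ^ m * 1) = xi μ (n + 2 * m - k) := by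
    conv_lhs => rw [hi, pow_add, mul_assoc, hμ.ip_X_pow_mul_X_pow_mul, ← hi]
    rw [hμ.ip_R (by rw [mul_one, natDegree_X_pow]; omega)]
    simp
  rw [← conj_ip, h2, Complex.conj_ofReal]

theorem IsChristoffelFactor.exists_connectionFormula (hG : IsChristoffelFactor μ m G)
    (hμ : IsNontrivial μ) (hm : 1 ≤ m) (n : ℕ) :
    ∃ (γ : ℂ) (a : ℕ → ℂ), ConnectionFormula μ m G n γ a := by
  have hν := hμ.christoffel (hG.ne_zero hm)
  set r := R (OPUC.christoffel μ G) n with hr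
  have hdeg : (G * r).natDegree ≤ n + 2 * m := by
    have hrd : r.natDegree ≤ n := natDegree_R_le _ n
    refine natDegree_mul_le.trans ?_
    rw [hG.natDegree_eq]
    omega
  have horth : ∀ j < n, ip μ (G * r) (X ^ (m + j) * (X - 1)) = 0 := by
    intro j hj
    rw [pow_add, mul_assoc, hG.ip_mul_X_pow_mul hμ]
    simpa using hν.ip_X_pow_mul_R (k := 0) (i := j) (n := n) (by omega) (by omega)
  obtain ⟨b, hb⟩ := hμ.exists_eq_sum_R n m hdeg horth
  have h0 := hG.coeff_top_of_eq_sum (γ := 1) (by rw [C_1, one_mul]; exact hb)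
  have hb0 : b 0 ≠ 0 := by
    intro hb0
    rw [hb0, zero_mul, one_mul] at h0
    exact mul_ne_zero (hG.coeff_two_mul_ne_zero hm) (hν.coeff_R_self_ne_zero n) h0
  refine ⟨(b 0)⁻¹, fun k => (b 0)⁻¹ * b k, connectionFormula_iff.2 ?_⟩
  rw [← hr, hb, Finset.mul_sum]
  refine Finset.sum_congr rfl fun k _ => ?_
  have : consOne (fun k => (b 0)⁻¹ * b k) k = (b 0)⁻¹ * b k := by
    rw [consOne]
    split_ifs with hk
    · rw [hk, inv_mul_cancel₀ hb0]
    · rfl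
  rw [this, C_mul]
  ring

theorem ConnectionFormula.coeff_top {n : ℕ} {γ : ℂ} {a : ℕ → ℂ}
    (h : ConnectionFormula μ m G n γ a) (hG : IsChristoffelFactor μ m G) :
    γ * (G.coeff (2 * m) * (R (OPUC.christoffel μ G) n).coeff n) =
      (R μ (n + 2 * m)).coeff (n + 2 * m) := by
  simpa [consOne] using hG.coeff_top_of_eq_sum (connectionFormula_iff.1 h)

theorem ConnectionFormula.coeff_zero {n : ℕ} {γ : ℂ} {a : ℕ → ℂ}
    (h : ConnectionFormula μ m G n γ a) (hm : 1 ≤ m) :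
    γ * (G.coeff 0 * (R (OPUC.christoffel μ G) n).coeff 0) =
      (R μ (n + 2 * m)).coeff 0 + a 1 * (R μ (n + 2 * m - 1)).coeff 0 := by
  have h1 := congrArg (fun p => p.coeff 0) (connectionFormula_iff.1 h)
  simpa [coeff_zero_sum_R μ hm, consOne, mul_coeff_zero] using h1

theorem ConnectionFormula.xi_eq {n : ℕ} {γ : ℂ} {a : ℕ → ℂ}
    (h : ConnectionFormula μ m G n γ a) (hG : IsChristoffelFactor μ m G) (hμ : IsNontrivial μ)
    (hm : 1 ≤ m) :
    γ * (xi (OPUC.christoffel μ G) n : ℂ) = (xi μ (n + 2 * m) : ℂ)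
      + ∑ j ∈ Finset.Icc 1 m, a (2 * j - 1) * (xi μ (n + 2 * m - 2 * j + 1) : ℂ)
      + ∑ j ∈ Finset.Icc 1 m, a (2 * j) * (xi μ (n + 2 * m - 2 * j) : ℂ) := by
  rw [hG.xi_of_eq_sum hμ hm (connectionFormula_iff.1 h), sum_range_two_mul_add_one]
  congr 1
  · congr 1
    · simp [consOne]
    · refine Finset.sum_congr rfl fun j hj => ?_
      have := Finset.mem_Icc.1 hj
      rw [consOne, if_neg (by omega),
        show n + 2 * m - (2 * j - 1) = n + 2 * m - 2 * j + 1 by omega]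
  · refine Finset.sum_congr rfl fun j hj => ?_
    have := Finset.mem_Icc.1 hj
    rw [consOne, if_neg (by omega)]

/-- The top coefficient determines `γ`, and linear independence then determines the `a j`. -/
theorem ConnectionFormula.unique {n : ℕ} {γ γ' : ℂ} {a a' : ℕ → ℂ}
    (h : ConnectionFormula μ m G n γ a) (h' : ConnectionFormula μ m G n γ' a')
    (hG : IsChristoffelFactor μ m G) (hμ : IsNontrivial μ) (hm : 1 ≤ m) :
    γ' = γ ∧ ∀ j ∈ Finset.Icc 1 (2 * m), a' j = a j := by
  have hν := hμ.christoffel (hG.ne_zero hm)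
  have hγ : γ' = γ :=
    mul_right_cancel₀ (mul_ne_zero (hG.coeff_two_mul_ne_zero hm) (hν.coeff_R_self_ne_zero n))
      ((h'.coeff_top hG).trans (h.coeff_top hG).symm)
  refine ⟨hγ, fun j hj => ?_⟩
  rw [Finset.mem_Icc] at hj
  subst hγ
  have h1 := (connectionFormula_iff.1 h').symm.trans (connectionFormula_iff.1 h)
  rw [← sub_eq_zero, ← Finset.sum_sub_distrib] at h1
  have h2 := hμ.eq_zero_of_sum_R_eq_zero n m (b := fun k => consOne a' k - consOne a k)
    (by rw [← h1]; refine Finset.sum_congr rfl fun k _ => ?_; rw [C_sub]; ring) j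
    (Finset.mem_range.2 (by omega))
  simpa [consOne, show j ≠ 0 by omega, sub_eq_zero] using h2

theorem ConnectionFormula.ne_zero {n : ℕ} {γ : ℂ} {a : ℕ → ℂ}
    (h : ConnectionFormula μ m G n γ a) (hG : IsChristoffelFactor μ m G) (hμ : IsNontrivial μ) :
    γ ≠ 0 := by
  rintro rfl
  have h1 := h.coeff_top hG
  rw [zero_mul] at h1
  exact hμ.coeff_R_self_ne_zero _ h1.symm

end OPUC

theorem mainTheorem6 (μ : Measure ℂ) (hμ : OPUC.IsNontrivial μ) (m : ℕ) (hm : 1 ≤ m)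
    (G : ℂ[X]) (hG : OPUC.IsChristoffelFactor μ m G) :
    -- the coefficients of the connection formula exist and are unique, for every `n ≥ 0`
    (∀ n : ℕ, ∃ (γ : ℂ) (a : ℕ → ℂ), OPUC.ConnectionFormula μ m G n γ a ∧
      ∀ (γ' : ℂ) (a' : ℕ → ℂ), OPUC.ConnectionFormula μ m G n γ' a' →
        γ' = γ ∧ ∀ j ∈ Finset.Icc 1 (2 * m), a' j = a j) ∧
    -- and they determine the parameters of the transformed measure
    (∀ (γ : ℕ → ℂ) (a : ℕ → ℕ → ℂ),
      (∀ n : ℕ, OPUC.ConnectionFormula μ m G n (γ n) (a n)) →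
      (∀ n : ℕ, γ n ≠ 0) ∧
      γ 0 = (conj (G.eval 0))⁻¹ *
        ∏ j ∈ Finset.Icc 1 (2 * m), (1 + Complex.I * (OPUC.c μ j : ℂ)) ∧
      ∀ n N : ℕ, 1 ≤ n → N = n + 2 * m →
        (1 - Complex.I * (OPUC.c μ (N - 1) : ℂ)) + a (n - 1) 1 ≠ 0 ∧
        γ n / γ (n - 1) =
          1 / 2 * ((1 - Complex.I * (OPUC.c μ (N - 1) : ℂ)) *
              (((1 - Complex.I * (OPUC.c μ N : ℂ)) + a n 1) /
                ((1 - Complex.I * (OPUC.c μ (N - 1) : ℂ)) + a (n - 1) 1))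
            + (1 + Complex.I * (OPUC.c μ N : ℂ))) ∧
        (OPUC.c (OPUC.christoffel μ G) n : ℂ) =
          Complex.I / 2 * (γ (n - 1) / γ n) *
            ((1 - Complex.I * (OPUC.c μ (N - 1) : ℂ)) *
              (((1 - Complex.I * (OPUC.c μ N : ℂ)) + a n 1) /
                ((1 - Complex.I * (OPUC.c μ (N - 1) : ℂ)) + a (n - 1) 1))
            - (1 + Complex.I * (OPUC.c μ N : ℂ))) ∧
        (OPUC.xi μ (N - 1) : ℂ)
            + ∑ j ∈ Finset.Icc 1 m, a (n - 1) (2 * j - 1) * (OPUC.xi μ (N - 2 * j) : ℂ)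
            + ∑ j ∈ Finset.Icc 1 m, a (n - 1) (2 * j) * (OPUC.xi μ (N - 2 * j - 1) : ℂ) ≠ 0 ∧
        (OPUC.g (OPUC.christoffel μ G) n : ℂ) =
          1 - 1 / 2 * (γ (n - 1) / γ n) *
            (((OPUC.xi μ N : ℂ)
                + ∑ j ∈ Finset.Icc 1 m, a n (2 * j - 1) * (OPUC.xi μ (N - 2 * j + 1) : ℂ)
                + ∑ j ∈ Finset.Icc 1 m, a n (2 * j) * (OPUC.xi μ (N - 2 * j) : ℂ)) /
              ((OPUC.xi μ (N - 1) : ℂ)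
                + ∑ j ∈ Finset.Icc 1 m, a (n - 1) (2 * j - 1) * (OPUC.xi μ (N - 2 * j) : ℂ)
                + ∑ j ∈ Finset.Icc 1 m,
                    a (n - 1) (2 * j) * (OPUC.xi μ (N - 2 * j - 1) : ℂ)))) := by
  refine ⟨fun n => ?_, fun γ a h => ?_⟩
  · obtain ⟨γ, a, h⟩ := hG.exists_connectionFormula hμ hm n
    exact ⟨γ, a, h, fun γ' a' h' => h.unique h' hG hμ hm⟩
  have hν := hμ.christoffel (hG.ne_zero hm)
  have hγ : ∀ n, γ n ≠ 0 := fun n => (h n).ne_zero hG hμ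
  have hL := hG.coeff_two_mul_ne_zero hm
  have hG0 : G.coeff 0 ≠ 0 := by simpa [hG.coeff_zero_eq] using hL
  refine ⟨hγ, ?_, ?_⟩
  · have h0 := (h 0).coeff_top hG
    rw [hν.coeff_R_self 0, zero_add, hμ.coeff_R_self] at h0
    rw [← coeff_zero_eq_eval_zero, hG.coeff_zero_eq, Complex.conj_conj, ← h0]
    simp only [Finset.Icc_eq_empty_of_lt zero_lt_one, Finset.prod_empty]
    field_simp
  rintro n N hn rfl
  obtain ⟨n, rfl⟩ : ∃ k, n = k + 1 := ⟨n - 1, by omega⟩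
  obtain ⟨M, hM⟩ : ∃ M, n + 2 * m = M + 1 := ⟨n + 2 * m - 1, by omega⟩
  have hM' : n + 1 + 2 * m = M + 2 := by omega
  have htop := (h (n + 1)).coeff_top hG
  have htop' := (h n).coeff_top hG
  have hbot := (h (n + 1)).coeff_zero hm
  have hbot' := (h n).coeff_zero hm
  have hxi := (h (n + 1)).xi_eq hG hμ hm
  have hxi' := (h n).xi_eq hG hμ hm
  have hxi0 : (OPUC.xi (OPUC.christoffel μ G) n : ℂ) ≠ 0 := by
    exact_mod_cast (hν.xi_pos n).ne'
  have hg := congrArg (fun x : ℝ => (x : ℂ)) (OPUC.xi_succ (OPUC.christoffel μ G) n)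
  simp only [Complex.ofReal_mul, Complex.ofReal_sub, Complex.ofReal_one,
    Complex.ofReal_ofNat] at hg
  -- the second denominator is `γ_{n-1} ξ_{n-1}(ν)`
  have hden : (OPUC.xi μ (n + 1 + 2 * m - 1) : ℂ)
      + ∑ j ∈ Finset.Icc 1 m, a n (2 * j - 1) * (OPUC.xi μ (n + 1 + 2 * m - 2 * j) : ℂ)
      + ∑ j ∈ Finset.Icc 1 m, a n (2 * j) * (OPUC.xi μ (n + 1 + 2 * m - 2 * j - 1) : ℂ) =
        γ n * (OPUC.xi (OPUC.christoffel μ G) n : ℂ) := by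
    rw [hxi']
    congr 1
    · congr 1
      · rw [show n + 1 + 2 * m - 1 = n + 2 * m by omega]
      · refine Finset.sum_congr rfl fun j hj => ?_
        have := Finset.mem_Icc.1 hj
        rw [show n + 1 + 2 * m - 2 * j = n + 2 * m - 2 * j + 1 by omega]
    · refine Finset.sum_congr rfl fun j hj => ?_
      rw [show n + 1 + 2 * m - 2 * j - 1 = n + 2 * m - 2 * j by omega]
  rw [Nat.add_sub_cancel, hden, ← hxi]
  rw [hM'] at htop hbot
  rw [hM] at htop' hbot'
  rw [hM', show M + 2 - 1 = M + 1 by omega]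
  rw [show M + 2 - 1 = M + 1 by omega, hμ.coeff_R_succ_zero (M + 1), hμ.coeff_R_succ_zero M,
    hν.coeff_R_succ_zero] at hbot
  rw [show M + 1 - 1 = M by omega, hμ.coeff_R_succ_zero M] at hbot'
  rw [hμ.coeff_R_succ (M + 1), hν.coeff_R_succ] at htop
  have hγ1 := hγ (n + 1)
  have hγ0 := hγ n
  have hl := hν.coeff_R_self_ne_zero n
  have hk := hν.coeff_R_zero_ne_zero n
  have hρ := hμ.coeff_R_zero_ne_zero M
  -- `hP` and `hQ` divide the coefficient comparisons of index `n` by those of index `n - 1`; their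
  -- sum gives the ratio of the `γ`s and their difference gives `c_n(ν)`
  have hP : γ (n + 1) * (1 + Complex.I * (OPUC.c (OPUC.christoffel μ G) (n + 1) : ℂ)) =
      γ n * (1 + Complex.I * (OPUC.c μ (M + 2) : ℂ)) := by
    refine mul_right_cancel₀ (mul_ne_zero hL hl) ?_
    linear_combination htop - (1 + Complex.I * (OPUC.c μ (M + 2) : ℂ)) * htop'
  have hd : (1 - Complex.I * (OPUC.c μ (M + 1) : ℂ)) + a n 1 ≠ 0 := by
    intro h0
    refine mul_ne_zero hγ0 (mul_ne_zero hG0 hk) ?_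
    linear_combination hbot' + (OPUC.R μ M).coeff 0 * h0
  have hQ : γ (n + 1) * (1 - Complex.I * (OPUC.c (OPUC.christoffel μ G) (n + 1) : ℂ)) =
      γ n * ((1 - Complex.I * (OPUC.c μ (M + 1) : ℂ)) *
        (((1 - Complex.I * (OPUC.c μ (M + 2) : ℂ)) + a (n + 1) 1) /
          ((1 - Complex.I * (OPUC.c μ (M + 1) : ℂ)) + a n 1))) := by
    rw [mul_div_assoc', mul_div_assoc', eq_div_iff hd]
    refine mul_right_cancel₀ (mul_ne_zero (mul_ne_zero hG0 hk) hρ) ?_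
    linear_combination ((1 - Complex.I * (OPUC.c μ (M + 1) : ℂ)) + a n 1) *
        (OPUC.R μ M).coeff 0 * hbot -
      (1 - Complex.I * (OPUC.c μ (M + 1) : ℂ)) *
        ((1 - Complex.I * (OPUC.c μ (M + 2) : ℂ)) + a (n + 1) 1) * (OPUC.R μ M).coeff 0 * hbot'
  generalize (1 - Complex.I * (OPUC.c μ (M + 1) : ℂ)) *
        (((1 - Complex.I * (OPUC.c μ (M + 2) : ℂ)) + a (n + 1) 1) /
          ((1 - Complex.I * (OPUC.c μ (M + 1) : ℂ)) + a n 1)) = A at hQ ⊢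
  refine ⟨hd, ?_, ?_, mul_ne_zero hγ0 hxi0, ?_⟩
  · rw [div_eq_iff hγ0]
    linear_combination (1 / 2) * hP + (1 / 2) * hQ
  · have hI := Complex.I_sq
    rw [mul_div_assoc', div_mul_eq_mul_div, eq_div_iff hγ1]
    linear_combination (Complex.I / 2) * hQ - (Complex.I / 2) * hP +
      (γ (n + 1) * (OPUC.c (OPUC.christoffel μ G) (n + 1) : ℂ)) * hI
  · rw [hg]
    field_simp
    ring
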